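/- Let $A$ and $B$ be two $n\times n$ positive definite (complex Hermitian) matrices, let $0\le t\le 1$ and $p>0$, and let $|||\cdot|||$ be any unitarily invariant norm on the space of $n\times n$ complex matrices, i.e. a norm with $|||UXV|||=|||X|||$ for all $X$ and all unitary $U,V$. Let $A\#_t B=A^{1/2}\left(A^{-1/2}BA^{-1/2}\right)^tA^{1/2}$ be the $t$-geometric mean of $A$ and $B$. Then $$|||A\#_t B|||\le |||e^{(1-t)\log A+t\log B}|||\le \left|\left|\left|\left((1-t)A^p+tB^p\right)^{1/p}\right|\right|\right|.$$ -/

import Mathlib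

open scoped ComplexOrder MatrixOrder

/-- A norm on the space of complex `n × n` matrices (a definite seminorm) is unitarily invariant
when multiplying its argument on either side by unitary matrices does not change its value. -/
structure IsUnitarilyInvariantNorm {n : Type*} [Fintype n] [DecidableEq n]
    (N : Seminorm ℂ (Matrix n n ℂ)) : Prop where
  eq_zero_of_map_eq_zero : ∀ X : Matrix n n ℂ, N X = 0 → X = 0
  unitary_mul_mul : ∀ U ∈ Matrix.unitaryGroup n ℂ, ∀ V ∈ Matrix.unitaryGroup n ℂ,
    ∀ X : Matrix n n ℂ, N (U * X * V) = N X

/-- The `t`-geometric mean `A #ₜ B = A^{1/2} (A^{-1/2} B A^{-1/2})^t A^{1/2}` of positive definite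
matrices. The real powers are those of the continuous functional calculus. -/
noncomputable def tGeometricMean {n : Type*} [Fintype n] [DecidableEq n]
    (t : ℝ) (A B : Matrix n n ℂ) : Matrix n n ℂ :=
  A ^ (1 / 2 : ℝ) * (A ^ (-(1 / 2) : ℝ) * B * A ^ (-(1 / 2) : ℝ)) ^ t * A ^ (1 / 2 : ℝ)

/-- The logarithm of a positive definite matrix, through the continuous functional calculus. -/
noncomputable def matrixLog {n : Type*} [Fintype n] [DecidableEq n]
    (A : Matrix n n ℂ) : Matrix n n ℂ :=
  cfc Real.log A

/-- The log Euclidean mean `e^{(1-t) log A + t log B}` of positive definite matrices. -/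
noncomputable def logEuclideanMean {n : Type*} [Fintype n] [DecidableEq n]
    (t : ℝ) (A B : Matrix n n ℂ) : Matrix n n ℂ :=
  NormedSpace.exp ((1 - t) • matrixLog A + t • matrixLog B)

/-- The power mean `((1-t) A^p + t B^p)^{1/p}` of positive definite matrices, for `p ≠ 0`. -/
noncomputable def matrixPowerMean {n : Type*} [Fintype n] [DecidableEq n]
    (t p : ℝ) (A B : Matrix n n ℂ) : Matrix n n ℂ :=
  ((1 - t) • A ^ p + t • B ^ p) ^ (1 / p)

/-! Both inequalities reduce to eigenvalues, since a unitarily invariant norm of a positive definite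
matrix depends only on its spectrum. For the left one, the eigenvalues of `A #ₜ B` are log-majorized
by those of `e^L`, where `L = (1-t) log A + t log B` (`sum_log_eigenvalues_le`). Compounds turn
products of the `k` largest eigenvalues into a largest eigenvalue and commute with `#ₜ`, so a bound
on the top eigenvalue suffices. The mean of the compounds of `e^{r log A}` and `e^{r log B}` lies
below their arithmetic mean, which agrees to first order in `r` with the compound of `e^{rL}`. With
`r = 2^{-j}`, applying the Ando–Hiai inequality `j` times (`tGeometricMean_mul_self_le`) returns to
`A` and `B` with a vanishing error. Fan dominance (`map_realDiagonal_le_of_sum_log_le`) then gives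
the norm inequality. For the right one, operator concavity of `log` gives `L ≤ (1/p) log((1-t)A^p +
tB^p)`, and `N ∘ exp` is monotone on Hermitian matrices (`map_exp_le_map_exp`), by Jensen's
inequality and Birkhoff's theorem. -/

namespace Matrix

/-! ### Compound matrices and Cauchy–Binet -/

/-- The `k`-th compound matrix: the matrix of all `k × k` minors. -/
def compound {m : ℕ} {R : Type*} [CommRing R] (k : ℕ) (M : Matrix (Fin m) (Fin m) R) :
    Matrix (Fin k ↪o Fin m) (Fin k ↪o Fin m) R :=
  of fun f g => (M.submatrix f g).det

section Compound

variable {m k : ℕ} {R : Type*} [CommRing R]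

theorem compound_apply (M : Matrix (Fin m) (Fin m) R) (f g : Fin k ↪o Fin m) :
    compound k M f g = (M.submatrix f g).det := rfl

/-- Expansion of the determinant of a product of rectangular matrices along the rows. -/
theorem det_mul_eq_sum_prod_mul_det (A : Matrix (Fin k) (Fin m) R) (B : Matrix (Fin m) (Fin k) R) :
    (A * B).det = ∑ p : Fin k → Fin m, (∏ i, A i (p i)) * (B.submatrix p id).det := by
  have h : (A * B) = fun i => ∑ j, A i j • B j := by
    ext i j
    simp [mul_apply, Finset.sum_apply]
  rw [h]
  change detRowAlternating _ = _
  rw [← AlternatingMap.coe_multilinearMap, MultilinearMap.map_sum]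
  refine Finset.sum_congr rfl fun p _ => ?_
  rw [MultilinearMap.map_smul_univ]
  rfl

/-- The Cauchy–Binet formula. -/
theorem det_mul_eq_sum_orderEmbedding (A : Matrix (Fin k) (Fin m) R)
    (B : Matrix (Fin m) (Fin k) R) :
    (A * B).det = ∑ f : Fin k ↪o Fin m, (A.submatrix id f).det * (B.submatrix f id).det := by
  have h : ∀ f : Fin k ↪o Fin m, (A.submatrix id f).det * (B.submatrix f id).det =
      ∑ σ : Equiv.Perm (Fin k), (∏ i, A i (f (σ i))) * (B.submatrix (f ∘ σ) id).det := by
    intro f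
    rw [← det_transpose, det_apply', Finset.sum_mul]
    refine Finset.sum_congr rfl fun σ _ => ?_
    have : B.submatrix (f ∘ σ) id = (B.submatrix f id).submatrix σ id := rfl
    rw [this, det_permute]
    simp only [transpose_apply, submatrix_apply, id]
    ring
  rw [det_mul_eq_sum_prod_mul_det, Finset.sum_congr rfl fun f _ => h f, ← Finset.sum_product']
  symm
  -- An injective `p` is uniquely an increasing map after a permutation (sort it); any other `p`
  -- repeats a row of `B`, so its term vanishes.
  refine Finset.sum_of_injOn (fun x => x.1 ∘ x.2) ?_ (fun _ _ => Finset.mem_coe.2 (Finset.mem_univ _))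
    ?_ fun _ _ => rfl
  · rintro ⟨f, σ⟩ - ⟨g, τ⟩ - h
    have hfg : f = g := by
      refine DFunLike.coe_injective ((f.strictMono.range_inj g.strictMono).1 ?_)
      have := congrArg Set.range h
      simpa [Set.range_comp] using this
    subst hfg
    have : σ = τ := Equiv.ext fun i => f.injective (congrFun h i)
    rw [this]
  · intro p _ hp
    have hinj : ¬ Function.Injective p := by
      intro hinj
      refine hp ⟨(OrderEmbedding.ofStrictMono (p ∘ Tuple.sort p)
        ((Tuple.monotone_sort p).strictMono_of_injective
          (hinj.comp (Tuple.sort p).injective)), (Tuple.sort p)⁻¹), by simp, ?_⟩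
      ext i
      simp
    obtain ⟨i, j, hij, hne⟩ : ∃ i j, p i = p j ∧ i ≠ j := by
      simpa [Function.Injective] using hinj
    rw [det_zero_of_row_eq hne, mul_zero]
    ext l
    simp [hij]

theorem compound_mul (A B : Matrix (Fin m) (Fin m) R) :
    compound k (A * B) = compound k A * compound k B := by
  ext f g
  have h : (A * B).submatrix f g = A.submatrix f id * B.submatrix id g := by
    ext; simp [mul_apply]
  rw [compound_apply, h, det_mul_eq_sum_orderEmbedding, mul_apply]
  rfl

/-- Distinct increasing `k`-tuples have distinct ranges of equal size, so an off-diagonal minor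
contains a zero row. -/
theorem compound_diagonal (d : Fin m → R) :
    compound k (diagonal d) = diagonal fun f : Fin k ↪o Fin m => ∏ i, d (f i) := by
  ext f g
  rw [compound_apply]
  by_cases h : f = g
  · subst h
    rw [submatrix_diagonal d f f.injective, det_diagonal, diagonal_apply_eq]
    rfl
  · rw [diagonal_apply_ne _ h]
    obtain ⟨i, hi⟩ : ∃ i, f i ∉ Set.range g := by
      by_contra! hc
      refine h (DFunLike.coe_injective ((f.strictMono.range_inj g.strictMono).1 ?_))
      have hsub : Set.range f ⊆ Set.range g := by rintro _ ⟨i, rfl⟩; exact hc i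
      refine Set.eq_of_subset_of_ncard_le hsub ?_ (Set.toFinite _)
      rw [Set.ncard_range_of_injective f.injective, Set.ncard_range_of_injective g.injective]
    refine det_eq_zero_of_row_eq_zero i fun j => ?_
    rw [submatrix_apply, diagonal_apply_ne]
    exact fun hj => hi ⟨j, hj.symm⟩

theorem compound_one : compound k (1 : Matrix (Fin m) (Fin m) R) = 1 := by
  rw [← diagonal_one, compound_diagonal]
  simp

theorem compound_conjTranspose [StarRing R] (A : Matrix (Fin m) (Fin m) R) :
    compound k Aᴴ = (compound k A)ᴴ := by
  ext f g
  rw [compound_apply, ← conjTranspose_submatrix, det_conjTranspose]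
  rfl

end Compound

end Matrix

/-! ### Functional calculus in a unitary eigenbasis -/

namespace Matrix

variable {n : Type*} [DecidableEq n]

/-- The complex diagonal matrix with given real diagonal entries. -/
def realDiagonal (d : n → ℝ) : Matrix n n ℂ := diagonal fun i => (d i : ℂ)

theorem realDiagonal_one : realDiagonal (fun _ : n => (1 : ℝ)) = 1 := by
  simp [realDiagonal]

theorem realDiagonal_isHermitian (d : n → ℝ) : (realDiagonal d).IsHermitian := by
  simp [realDiagonal, IsHermitian, diagonal_conjTranspose, Pi.star_def]

theorem conjTranspose_realDiagonal (d : n → ℝ) : (realDiagonal d)ᴴ = realDiagonal d :=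
  realDiagonal_isHermitian d

theorem realDiagonal_add (d e : n → ℝ) :
    realDiagonal d + realDiagonal e = realDiagonal (d + e) := by
  simp [realDiagonal, diagonal_add]

theorem smul_realDiagonal (c : ℝ) (d : n → ℝ) :
    c • realDiagonal d = realDiagonal (c • d) := by
  ext i j
  by_cases h : i = j <;> simp [realDiagonal, h]

theorem realDiagonal_le_realDiagonal {d e : n → ℝ} :
    realDiagonal d ≤ realDiagonal e ↔ d ≤ e := by
  rw [le_iff, realDiagonal, realDiagonal, diagonal_sub, posSemidef_diagonal_iff]
  simp only [sub_nonneg, Complex.real_le_real, Pi.le_def]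

theorem realDiagonal_posDef {d : n → ℝ} (hd : ∀ i, 0 < d i) : (realDiagonal d).PosDef := by
  rw [realDiagonal, posDef_diagonal_iff]
  exact fun i => by exact_mod_cast hd i

variable [Fintype n]

theorem realDiagonal_mul (d e : n → ℝ) :
    realDiagonal d * realDiagonal e = realDiagonal (d * e) := by
  simp [realDiagonal]

/-- Conjugating real diagonal matrices by a unitary is a homomorphism of star algebras. -/
def unitaryDiagonalHom (U : unitaryGroup n ℂ) : (n → ℝ) →⋆ₐ[ℝ] Matrix n n ℂ where
  toFun d := U * realDiagonal d * (U : Matrix n n ℂ)ᴴ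
  map_one' := by
    have : (U : Matrix n n ℂ) * (U : Matrix n n ℂ)ᴴ = 1 := Unitary.coe_mul_star_self U
    rw [show (1 : n → ℝ) = fun _ => 1 from rfl, realDiagonal_one, mul_one, this]
  map_mul' d e := by
    have : (U : Matrix n n ℂ)ᴴ * (U : Matrix n n ℂ) = 1 := Unitary.coe_star_mul_self U
    rw [← realDiagonal_mul]
    simp only [mul_assoc]
    rw [← mul_assoc (U : Matrix n n ℂ)ᴴ U, this, one_mul]
  map_zero' := by
    change _ * realDiagonal (fun _ => 0) * _ = _
    simp [realDiagonal]
  map_add' d e := by rw [← realDiagonal_add, mul_add, add_mul]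
  commutes' r := by
    have : (U : Matrix n n ℂ) * (U : Matrix n n ℂ)ᴴ = 1 := Unitary.coe_mul_star_self U
    have h : realDiagonal (algebraMap ℝ (n → ℝ) r) = r • (1 : Matrix n n ℂ) := by
      rw [← realDiagonal_one, smul_realDiagonal]
      congr 1
      ext
      simp
    rw [h, mul_smul_comm, smul_mul_assoc, mul_one, this, Algebra.algebraMap_eq_smul_one]
  map_star' d := by
    change _ = (_ * _ * _)ᴴ
    rw [conjTranspose_mul, conjTranspose_mul, conjTranspose_conjTranspose,
      conjTranspose_realDiagonal, star_trivial, mul_assoc]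

theorem cfc_unitary_mul_realDiagonal_mul {U : Matrix n n ℂ} (hU : U ∈ unitaryGroup n ℂ)
    (d : n → ℝ) (f : ℝ → ℝ) :
    cfc f (U * realDiagonal d * Uᴴ) = U * realDiagonal (f ∘ d) * Uᴴ := by
  set A := U * realDiagonal d * Uᴴ with hA
  have hAφ : A = unitaryDiagonalHom ⟨U, hU⟩ d := rfl
  have hAsa : IsSelfAdjoint A := by
    rw [hAφ]
    exact (IsSelfAdjoint.all d).map _
  -- Interpolating `f` on the spectrum and on the values of `d` together avoids identifying the two
  -- sets.
  let s := (finite_real_spectrum (A := A)).toFinset ∪ Finset.univ.image d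
  let q := Lagrange.interpolate s id f
  have hq : ∀ x ∈ s, q.eval x = f x := fun x hx =>
    Lagrange.eval_interpolate_at_node f (Set.injOn_id _) hx
  have h₁ : cfc f A = cfc q.eval A :=
    cfc_congr fun x hx => (hq x (Finset.mem_union_left _ (by simpa using hx))).symm
  have h₂ : Polynomial.aeval d q = f ∘ d := by
    ext i
    rw [Polynomial.aeval_pi_apply]
    exact hq _ (Finset.mem_union_right _ (Finset.mem_image_of_mem d (Finset.mem_univ i)))
  rw [h₁, cfc_polynomial q A hAsa, hAφ]
  erw [Polynomial.aeval_algHom_apply (unitaryDiagonalHom ⟨U, hU⟩).toAlgHom d q]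
  rw [h₂]
  rfl

theorem IsHermitian.eq_unitary_mul_realDiagonal_mul {A : Matrix n n ℂ} (hA : A.IsHermitian) :
    A = hA.eigenvectorUnitary * realDiagonal hA.eigenvalues *
      (hA.eigenvectorUnitary : Matrix n n ℂ)ᴴ := by
  conv_lhs => rw [hA.spectral_theorem, Unitary.conjStarAlgAut_apply]
  rfl

end Matrix

/-! ### The geometric mean under congruence -/

namespace Matrix

theorem mul_mul_conjTranspose_le {n : Type*} [Fintype n] {A B : Matrix n n ℂ} (h : A ≤ B) (X : Matrix n n ℂ) :
    X * A * Xᴴ ≤ X * B * Xᴴ := by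
  simpa [star_eq_conjTranspose] using star_right_conjugate_le_conjugate h X

variable {n : Type*} [Fintype n] [DecidableEq n]

theorem PosDef.rpow {A : Matrix n n ℂ} (hA : A.PosDef) (t : ℝ) : (A ^ t).PosDef :=
  isStrictlyPositive_iff_posDef.1 ((isStrictlyPositive_iff_posDef.2 hA).rpow A t)

theorem PosDef.rpow_mul_rpow {A : Matrix n n ℂ} (hA : A.PosDef) (s t : ℝ) :
    A ^ s * A ^ t = A ^ (s + t) :=
  (CFC.rpow_add hA.isUnit).symm

theorem PosDef.rpow_zero {A : Matrix n n ℂ} (hA : A.PosDef) : A ^ (0 : ℝ) = 1 :=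
  CFC.rpow_zero A hA.posSemidef.nonneg

theorem PosDef.rpow_one {A : Matrix n n ℂ} (hA : A.PosDef) : A ^ (1 : ℝ) = A :=
  CFC.rpow_one A hA.posSemidef.nonneg

theorem unitary_mul_realDiagonal_mul_rpow {U : Matrix n n ℂ} (hU : U ∈ unitaryGroup n ℂ)
    {d : n → ℝ} (hd : ∀ i, 0 < d i) (t : ℝ) :
    (U * realDiagonal d * Uᴴ) ^ t = U * realDiagonal (fun i => d i ^ t) * Uᴴ := by
  have h : 0 ≤ U * realDiagonal d * Uᴴ :=
    ((realDiagonal_posDef hd).posSemidef.mul_mul_conjTranspose_same U).nonneg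
  rw [CFC.rpow_eq_cfc_real h, cfc_unitary_mul_realDiagonal_mul hU]
  rfl

theorem PosDef.mul_mul_conjTranspose_of_isUnit {A X : Matrix n n ℂ} (hA : A.PosDef)
    (hX : IsUnit X) : (X * A * Xᴴ).PosDef :=
  hA.mul_mul_conjTranspose_same (vecMul_injective_of_isUnit hX)

theorem posDef_mul_conjTranspose_of_isUnit {X : Matrix n n ℂ} (hX : IsUnit X) :
    (X * Xᴴ).PosDef := by
  simpa using PosDef.one.mul_mul_conjTranspose_of_isUnit hX

/-- The geometric mean may be computed from any simultaneous diagonalization by congruence. -/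
theorem tGeometricMean_mul_realDiagonal_mul {X : Matrix n n ℂ} (hX : IsUnit X) {d : n → ℝ}
    (hd : ∀ i, 0 < d i) (t : ℝ) :
    tGeometricMean t (X * Xᴴ) (X * realDiagonal d * Xᴴ) =
      X * realDiagonal (fun i => d i ^ t) * Xᴴ := by
  have hA := posDef_mul_conjTranspose_of_isUnit hX
  rw [tGeometricMean]
  set A := X * Xᴴ with hAdef
  set S := A ^ (1 / 2 : ℝ) with hS
  set T := A ^ (-(1 / 2) : ℝ) with hT
  have hST : S * T = 1 := by
    rw [hS, hT, hA.rpow_mul_rpow, add_neg_cancel, hA.rpow_zero]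
  have hTS : T * S = 1 := by
    rw [hS, hT, hA.rpow_mul_rpow, neg_add_cancel, hA.rpow_zero]
  have hSS : S * S = A := by
    rw [hS, hA.rpow_mul_rpow, add_halves, hA.rpow_one]
  have hSh : Sᴴ = S := (hA.rpow _).1
  have hTh : Tᴴ = T := (hA.rpow _).1
  have hXS : X = S * (T * X) := by rw [← mul_assoc, hST, one_mul]
  -- Polar decomposition: `X = A^{1/2} (TX)` with `TX` unitary, so `TX` diagonalizes `A^{-1/2} B
  -- A^{-1/2}`.
  have hU : T * X ∈ unitaryGroup n ℂ := by
    rw [mem_unitaryGroup_iff, star_eq_conjTranspose, conjTranspose_mul, hTh]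
    calc T * X * (Xᴴ * T) = T * A * T := by rw [hAdef]; simp only [mul_assoc]
      _ = (T * S) * (S * T) := by rw [← hSS]; simp only [mul_assoc]
      _ = 1 := by rw [hST, hTS, one_mul]
  have h₁ : T * (X * realDiagonal d * Xᴴ) * T = (T * X) * realDiagonal d * (T * X)ᴴ := by
    rw [conjTranspose_mul, hTh]
    simp only [mul_assoc]
  rw [h₁, unitary_mul_realDiagonal_mul_rpow hU hd]
  conv_rhs => rw [hXS]
  rw [conjTranspose_mul S, hSh]
  simp only [mul_assoc]

/-- Two positive definite matrices are simultaneously diagonalizable by congruence. -/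
theorem PosDef.exists_simultaneous_diagonalization {A B : Matrix n n ℂ} (hA : A.PosDef)
    (hB : B.PosDef) : ∃ X : Matrix n n ℂ, IsUnit X ∧ ∃ d : n → ℝ, (∀ i, 0 < d i) ∧
      A = X * Xᴴ ∧ B = X * realDiagonal d * Xᴴ := by
  set S := A ^ (1 / 2 : ℝ) with hS
  set T := A ^ (-(1 / 2) : ℝ) with hT
  have hST : S * T = 1 := by
    rw [hS, hT, hA.rpow_mul_rpow, add_neg_cancel, hA.rpow_zero]
  have hTS : T * S = 1 := by
    rw [hS, hT, hA.rpow_mul_rpow, neg_add_cancel, hA.rpow_zero]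
  have hSS : S * S = A := by
    rw [hS, hA.rpow_mul_rpow, add_halves, hA.rpow_one]
  have hSh : Sᴴ = S := (hA.rpow _).1
  have hTh : Tᴴ = T := (hA.rpow _).1
  have hC : (T * B * Tᴴ).PosDef := hB.mul_mul_conjTranspose_of_isUnit (hA.rpow _).isUnit
  set U : Matrix n n ℂ := hC.1.eigenvectorUnitary.1
  have hU : U * Uᴴ = 1 := Unitary.coe_mul_star_self hC.1.eigenvectorUnitary
  have hspec := hC.1.eq_unitary_mul_realDiagonal_mul
  refine ⟨S * U, (hA.rpow _).isUnit.mul (IsUnit.of_mul_eq_one _ hU), hC.1.eigenvalues,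
    hC.eigenvalues_pos, ?_, ?_⟩
  · calc A = S * (U * Uᴴ) * S := by rw [hU, mul_one, hSS]
      _ = _ := by rw [conjTranspose_mul, hSh]; simp only [mul_assoc]
  · calc B = (S * T) * B * (T * S) := by rw [hST, hTS, one_mul, mul_one]
      _ = S * (T * B * Tᴴ) * S := by rw [hTh]; simp only [mul_assoc]
      _ = S * (U * realDiagonal hC.1.eigenvalues * Uᴴ) * S := congrArg (S * · * S) hspec
      _ = _ := by
        rw [conjTranspose_mul, hSh]
        simp only [mul_assoc]

theorem PosDef.tGeometricMean {A B : Matrix n n ℂ} (hA : A.PosDef) (hB : B.PosDef) (t : ℝ) :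
    (tGeometricMean t A B).PosDef := by
  obtain ⟨X, hX, d, hd, rfl, rfl⟩ := hA.exists_simultaneous_diagonalization hB
  rw [tGeometricMean_mul_realDiagonal_mul hX hd]
  exact (realDiagonal_posDef fun i => Real.rpow_pos_of_pos (hd i) t).mul_mul_conjTranspose_of_isUnit
    hX

theorem realDiagonal_isUnit {d : n → ℝ} (hd : ∀ i, 0 < d i) : IsUnit (realDiagonal d) :=
  (realDiagonal_posDef hd).isUnit

/-- Congruence by `X D` of a diagonal matrix is congruence by `X` of a diagonal matrix. -/
theorem mul_realDiagonal_congr (X : Matrix n n ℂ) (c d : n → ℝ) :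
    (X * realDiagonal c) * realDiagonal d * (X * realDiagonal c)ᴴ =
      X * realDiagonal (fun i => c i * d i * c i) * Xᴴ := by
  rw [conjTranspose_mul, conjTranspose_realDiagonal]
  calc _ = X * (realDiagonal c * realDiagonal d * realDiagonal c) * Xᴴ := by
        simp only [mul_assoc]
    _ = _ := by rw [realDiagonal_mul, realDiagonal_mul]; rfl

theorem mul_realDiagonal_mul_conjTranspose_self (X : Matrix n n ℂ) (c : n → ℝ) :
    (X * realDiagonal c) * (X * realDiagonal c)ᴴ =
      X * realDiagonal (fun i => c i * c i) * Xᴴ := by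
  have := mul_realDiagonal_congr X c fun _ => 1
  rw [realDiagonal_one, mul_one] at this
  simpa using this

/-- The geometric mean of two matrices diagonalized by the same congruence. -/
theorem tGeometricMean_congr_realDiagonal {X : Matrix n n ℂ} (hX : IsUnit X) {c d : n → ℝ}
    (hc : ∀ i, 0 < c i) (hd : ∀ i, 0 < d i) (t : ℝ) :
    tGeometricMean t (X * realDiagonal c * Xᴴ) (X * realDiagonal d * Xᴴ) =
      X * realDiagonal (fun i => c i ^ (1 - t) * d i ^ t) * Xᴴ := by
  -- Absorbing `√c` into `X` makes the first matrix `Y Yᴴ` and leaves the ratios `d / c` in the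
  -- second.
  have hs : ∀ i, 0 < √(c i) := fun i => Real.sqrt_pos.2 (hc i)
  have h := tGeometricMean_mul_realDiagonal_mul (hX.mul (realDiagonal_isUnit hs))
    (fun i => div_pos (hd i) (hc i)) t
  rw [mul_realDiagonal_mul_conjTranspose_self, mul_realDiagonal_congr,
    mul_realDiagonal_congr] at h
  convert h using 5
  · ext i
    exact (Real.mul_self_sqrt (hc i).le).symm
  · ext i
    have := (hc i).ne'
    rw [mul_right_comm, Real.mul_self_sqrt (hc i).le]
    field_simp
  · rename_i i
    rw [mul_right_comm, Real.mul_self_sqrt (hc i).le, Real.div_rpow (hd i).le (hc i).le,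
      Real.rpow_sub (hc i), Real.rpow_one]
    ring

/-- Clear from the diagonal entries `c^{1-t} d^t`; it carries monotonicity in one argument over to
the other. -/
theorem PosDef.tGeometricMean_comm {A B : Matrix n n ℂ} (hA : A.PosDef) (hB : B.PosDef) (t : ℝ) :
    _root_.tGeometricMean t A B = _root_.tGeometricMean (1 - t) B A := by
  obtain ⟨X, hX, d, hd, rfl, rfl⟩ := hA.exists_simultaneous_diagonalization hB
  have h1 : ∀ _ : n, (0 : ℝ) < 1 := fun _ => one_pos
  have h : X * Xᴴ = X * realDiagonal (fun _ => 1) * Xᴴ := by rw [realDiagonal_one, mul_one]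
  rw [h, tGeometricMean_congr_realDiagonal hX h1 hd, tGeometricMean_congr_realDiagonal hX hd h1]
  simp [mul_comm]

-- The Löwner–Heinz inequality between two congruences.
open scoped Matrix.Norms.L2Operator in
theorem tGeometricMean_mono_right {A B B' : Matrix n n ℂ} (hA : A.PosDef) (hB : B ≤ B')
    {t : ℝ} (ht : t ∈ Set.Icc (0 : ℝ) 1) :
    tGeometricMean t A B ≤ tGeometricMean t A B' := by
  rw [tGeometricMean, tGeometricMean]
  have hS : (A ^ (1 / 2 : ℝ))ᴴ = A ^ (1 / 2 : ℝ) := (hA.rpow _).1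
  have hT : (A ^ (-(1 / 2) : ℝ))ᴴ = A ^ (-(1 / 2) : ℝ) := (hA.rpow _).1
  have h := mul_mul_conjTranspose_le hB (A ^ (-(1 / 2) : ℝ))
  have h' := mul_mul_conjTranspose_le (CFC.rpow_le_rpow ht h) (A ^ (1 / 2 : ℝ))
  rwa [hS, hT] at h'

theorem tGeometricMean_mono {A A' B B' : Matrix n n ℂ} (hA : A.PosDef)
    (hA' : A'.PosDef) (hB' : B'.PosDef) (hAA' : A ≤ A') (hBB' : B ≤ B')
    {t : ℝ} (ht : t ∈ Set.Icc (0 : ℝ) 1) :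
    tGeometricMean t A B ≤ tGeometricMean t A' B' := by
  refine (tGeometricMean_mono_right hA hBB' ht).trans ?_
  rw [hA.tGeometricMean_comm hB', hA'.tGeometricMean_comm hB']
  exact tGeometricMean_mono_right hB' hAA' ⟨by linarith [ht.2], by linarith [ht.1]⟩

/-- The geometric mean is at most the arithmetic mean. -/
theorem tGeometricMean_le_arith {A B : Matrix n n ℂ} (hA : A.PosDef) (hB : B.PosDef)
    {t : ℝ} (ht : t ∈ Set.Icc (0 : ℝ) 1) :
    tGeometricMean t A B ≤ (1 - t) • A + t • B := by
  obtain ⟨X, hX, d, hd, rfl, rfl⟩ := hA.exists_simultaneous_diagonalization hB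
  rw [tGeometricMean_mul_realDiagonal_mul hX hd]
  have h : (1 - t) • (X * Xᴴ) + t • (X * realDiagonal d * Xᴴ) =
      X * realDiagonal (fun i => (1 - t) + t * d i) * Xᴴ := by
    have : realDiagonal (fun i => (1 - t) + t * d i) = (1 - t) • 1 + t • realDiagonal d := by
      rw [← realDiagonal_one, smul_realDiagonal, smul_realDiagonal, realDiagonal_add]
      congr 1
      ext i
      simp
    rw [this]
    simp [mul_add, add_mul]
  rw [h]
  refine mul_mul_conjTranspose_le (realDiagonal_le_realDiagonal.2 fun i => ?_) X
  have := Real.geom_mean_le_arith_mean2_weighted (sub_nonneg.2 ht.2) ht.1 zero_le_one (hd i).le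
    (by ring)
  simpa using this

/-! ### The Ando–Hiai inequality -/

-- By the C*-identity both bounds say `‖Y‖² ≤ μ`.
open scoped Matrix.Norms.L2Operator in
theorem conjTranspose_mul_self_le_of_mul_conjTranspose_self_le {Y : Matrix n n ℂ} {μ : ℝ}
    (hμ : 0 ≤ μ) (h : Y * Yᴴ ≤ μ • 1) : Yᴴ * Y ≤ μ • 1 := by
  have h0 : 0 ≤ Y * Yᴴ := (posSemidef_self_mul_conjTranspose Y).nonneg
  have h1 : ‖Y * Yᴴ‖ ≤ μ := by
    rw [CStarAlgebra.norm_le_iff_le_algebraMap _ hμ h0, Algebra.algebraMap_eq_smul_one]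
    exact h
  rw [← Algebra.algebraMap_eq_smul_one, ← CStarAlgebra.norm_le_iff_le_algebraMap _ hμ
    (posSemidef_conjTranspose_mul_self Y).nonneg]
  have e1 : ‖Y * Yᴴ‖ = ‖Y‖ * ‖Y‖ := CStarRing.norm_self_mul_star
  have e2 : ‖Yᴴ * Y‖ = ‖Y‖ * ‖Y‖ := CStarRing.norm_star_mul_self
  rw [e2, ← e1]
  exact h1

/-- The Ando–Hiai inequality for squares. -/
theorem tGeometricMean_mul_self_le {A B : Matrix n n ℂ} (hA : A.PosDef) (hB : B.PosDef)
    {t : ℝ} (ht : t ∈ Set.Icc (0 : ℝ) 1) {μ : ℝ} (hμ : 0 < μ)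
    (h : tGeometricMean t A B ≤ μ • 1) : tGeometricMean t (A * A) (B * B) ≤ (μ ^ 2) • 1 := by
  obtain ⟨X, hX, d, hd, hAX, hBX⟩ := hA.exists_simultaneous_diagonalization hB
  have hG : tGeometricMean t A B = X * realDiagonal (fun i => d i ^ t) * Xᴴ := by
    rw [hAX, hBX, tGeometricMean_mul_realDiagonal_mul hX hd]
  have hp : ∀ (s : ℝ) i, 0 < d i ^ s := fun s i => Real.rpow_pos_of_pos (hd i) s
  -- `Xᴴ X ≤ μ D⁻ᵗ`
  have hXX : Xᴴ * X ≤ realDiagonal fun i => μ * d i ^ (-t) := by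
    set D := realDiagonal fun i => d i ^ (t / 2) with hD
    set D' := realDiagonal fun i => d i ^ (-t / 2) with hD'
    have hDD' : D * D' = 1 := by
      rw [hD, hD', realDiagonal_mul, ← realDiagonal_one]
      congr 1
      ext i
      rw [Pi.mul_apply, ← Real.rpow_add (hd i)]
      simp [neg_div]
    -- For `Y = X D` the hypothesis is `Y Yᴴ ≤ μ`; passing to `Yᴴ Y` and conjugating by `D⁻¹`
    -- isolates `Xᴴ X`.
    have hY : (X * D) * (X * D)ᴴ ≤ μ • 1 := by
      rw [hG] at h
      rw [hD, mul_realDiagonal_mul_conjTranspose_self]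
      convert h using 5 with i
      rw [← Real.rpow_add (hd i), add_halves]
    have h1 := mul_mul_conjTranspose_le
      (conjTranspose_mul_self_le_of_mul_conjTranspose_self_le hμ.le hY) D'
    have hD'h : D'ᴴ = D' := conjTranspose_realDiagonal _
    have hDh : Dᴴ = D := conjTranspose_realDiagonal _
    have hD'D : D' * D = 1 := mul_eq_one_comm.1 hDD'
    have e1 : D' * ((X * D)ᴴ * (X * D)) * D'ᴴ = Xᴴ * X := by
      rw [conjTranspose_mul, hDh, hD'h]
      calc _ = (D' * D) * (Xᴴ * X) * (D * D') := by simp only [mul_assoc]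
        _ = _ := by rw [hDD', hD'D, one_mul, mul_one]
    have e2 : D' * (μ • 1) * D'ᴴ = realDiagonal fun i => μ * d i ^ (-t) := by
      rw [hD'h, mul_smul_comm, mul_one, smul_mul_assoc, hD', realDiagonal_mul, smul_realDiagonal]
      congr 1
      ext i
      rw [Pi.smul_apply, Pi.mul_apply, ← Real.rpow_add (hd i), add_halves, smul_eq_mul]
    rwa [e1, e2] at h1
  -- `A² = X (Xᴴ X) Xᴴ` and `B² = X D (Xᴴ X) D Xᴴ` with `D = diag d`; the bound goes into the middle
  -- factor.
  have hAA : A * A ≤ X * realDiagonal (fun i => μ * d i ^ (-t)) * Xᴴ := by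
    have := mul_mul_conjTranspose_le hXX X
    rw [hAX]
    simpa only [mul_assoc] using this
  have hBB : B * B ≤ X * realDiagonal (fun i => μ * d i ^ (2 - t)) * Xᴴ := by
    have := mul_mul_conjTranspose_le hXX (X * realDiagonal d)
    rw [mul_realDiagonal_congr, conjTranspose_mul, conjTranspose_realDiagonal] at this
    convert this using 1
    · rw [hBX]
      simp only [mul_assoc]
    · congr 3
      ext i
      rw [Real.rpow_sub (hd i), Real.rpow_neg (hd i).le, Real.rpow_two]
      ring
  have hsq : ∀ {C : Matrix n n ℂ}, C.PosDef → (C * C).PosDef := fun {C} hC => by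
    have := posDef_mul_conjTranspose_of_isUnit hC.isUnit
    rwa [hC.1] at this
  have hc : ∀ (s : ℝ) i, 0 < μ * d i ^ s := fun s i => mul_pos hμ (hp s i)
  refine (tGeometricMean_mono (hsq hA)
    ((realDiagonal_posDef (hc _)).mul_mul_conjTranspose_of_isUnit hX)
    ((realDiagonal_posDef (hc _)).mul_mul_conjTranspose_of_isUnit hX) hAA hBB ht).trans ?_
  rw [tGeometricMean_congr_realDiagonal hX (hc _) (hc _)]
  -- The exponents combine as `-t(1-t) + (2-t)t = t`, which recovers `A #ₜ B` with one factor `μ`;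
  -- the hypothesis supplies the other.
  have e : X * realDiagonal (fun i => (μ * d i ^ (-t)) ^ (1 - t) * (μ * d i ^ (2 - t)) ^ t) * Xᴴ =
      μ • tGeometricMean t A B := by
    rw [hG, ← smul_mul_assoc, ← mul_smul_comm, smul_realDiagonal]
    congr 3
    ext i
    rw [Real.mul_rpow hμ.le (hp _ i).le, Real.mul_rpow hμ.le (hp _ i).le, mul_mul_mul_comm,
      ← Real.rpow_add hμ, ← Real.rpow_mul (hd i).le, ← Real.rpow_mul (hd i).le,
      ← Real.rpow_add (hd i), sub_add_cancel, Real.rpow_one, Pi.smul_apply, smul_eq_mul]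
    congr 2
    ring
  rw [e, pow_two, mul_smul]
  exact smul_le_smul_of_nonneg_left h hμ.le

end Matrix

/-! ### Compounds and log-majorization -/

namespace Matrix

variable {n : Type*} [Fintype n] [DecidableEq n] {m : ℕ}

/-- The compound matrix of a matrix over an index type enumerated by `Fin m`. -/
def compoundHom (e : Fin m ≃ n) (k : ℕ) :
    Matrix n n ℂ →* Matrix (Fin k ↪o Fin m) (Fin k ↪o Fin m) ℂ where
  toFun M := compound k (M.submatrix e e)
  map_one' := by rw [submatrix_one_equiv, compound_one]
  map_mul' A B := by rw [← compound_mul, submatrix_mul_equiv]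

variable (e : Fin m ≃ n) (k : ℕ)

theorem compoundHom_apply (M : Matrix n n ℂ) :
    compoundHom e k M = compound k (M.submatrix e e) := rfl

theorem compoundHom_conjTranspose (M : Matrix n n ℂ) :
    compoundHom e k Mᴴ = (compoundHom e k M)ᴴ := by
  rw [compoundHom_apply, ← conjTranspose_submatrix, compound_conjTranspose, compoundHom_apply]

theorem compoundHom_realDiagonal (d : n → ℝ) :
    compoundHom e k (realDiagonal d) =
      realDiagonal fun f : Fin k ↪o Fin m => ∏ i, d (e (f i)) := by
  have h : (realDiagonal d).submatrix e e = diagonal fun i => ((d (e i) : ℝ) : ℂ) :=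
    submatrix_diagonal_equiv _ e
  rw [compoundHom_apply, h, compound_diagonal, realDiagonal]
  simp

theorem PosDef.compoundHom {A : Matrix n n ℂ} (hA : A.PosDef) : (compoundHom e k A).PosDef := by
  obtain ⟨X, hX, -, -, rfl, -⟩ := hA.exists_simultaneous_diagonalization hA
  rw [map_mul, compoundHom_conjTranspose]
  exact posDef_mul_conjTranspose_of_isUnit (hX.map _)

/-- Taking compounds commutes with the geometric mean. -/
theorem compoundHom_tGeometricMean {A B : Matrix n n ℂ} (hA : A.PosDef) (hB : B.PosDef) (t : ℝ) :
    compoundHom e k (tGeometricMean t A B) =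
      tGeometricMean t (compoundHom e k A) (compoundHom e k B) := by
  obtain ⟨X, hX, d, hd, rfl, rfl⟩ := hA.exists_simultaneous_diagonalization hB
  rw [tGeometricMean_mul_realDiagonal_mul hX hd]
  simp only [map_mul, compoundHom_conjTranspose, compoundHom_realDiagonal]
  rw [tGeometricMean_mul_realDiagonal_mul (hX.map _) fun f => Finset.prod_pos fun i _ => hd _]
  congr 3
  ext f
  exact (Real.finsetProd_rpow _ _ (fun i _ => (hd _).le) t)

/-- The compound of a unitary is unitary, so the eigenvalues of the compound are the `k`-fold
products. -/
theorem compoundHom_le_smul_one_iff {U : Matrix n n ℂ} (hU : U ∈ unitaryGroup n ℂ) (d : n → ℝ)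
    (ν : ℝ) : compoundHom e k (U * realDiagonal d * Uᴴ) ≤ ν • 1 ↔
      ∀ f : Fin k ↪o Fin m, ∏ i, d (e (f i)) ≤ ν := by
  set V := compoundHom e k U with hV
  have h1 : V * Vᴴ = 1 := by
    rw [hV, ← compoundHom_conjTranspose, ← map_mul, ← star_eq_conjTranspose,
      mem_unitaryGroup_iff.1 hU, map_one]
  have h2 : Vᴴ * V = 1 := mul_eq_one_comm.1 h1
  have hν : (ν • 1 : Matrix (Fin k ↪o Fin m) (Fin k ↪o Fin m) ℂ) = realDiagonal fun _ => ν := by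
    rw [← realDiagonal_one, smul_realDiagonal]
    congr 1
    ext
    simp
  rw [map_mul, map_mul, compoundHom_conjTranspose, compoundHom_realDiagonal, ← hV]
  set D := realDiagonal fun f : Fin k ↪o Fin m => ∏ i, d (e (f i)) with hD
  constructor
  · intro h
    have h' := mul_mul_conjTranspose_le h Vᴴ
    have e1 : Vᴴ * (V * D * Vᴴ) * Vᴴᴴ = D := by
      rw [conjTranspose_conjTranspose]
      calc _ = (Vᴴ * V) * D * (Vᴴ * V) := by simp only [mul_assoc]
        _ = D := by rw [h2, one_mul, mul_one]
    rw [e1, mul_smul_comm, smul_mul_assoc, mul_one, conjTranspose_conjTranspose, h2, hν, hD,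
      realDiagonal_le_realDiagonal] at h'
    exact h'
  · intro h
    have h' := mul_mul_conjTranspose_le
      (hD ▸ realDiagonal_le_realDiagonal.2 h : D ≤ realDiagonal fun _ => ν) V
    rwa [← hν, mul_smul_comm, smul_mul_assoc, mul_one, h1] at h'

/-- Shows that the initial segment maximizes sums of a decreasing sequence over increasing
`k`-tuples. -/
theorem _root_.Fin.castLE_le_orderEmbedding {k m : ℕ} (hk : k ≤ m) (f : Fin k ↪o Fin m)
    (i : Fin k) : Fin.castLE hk i ≤ f i := by
  obtain ⟨i, hi⟩ := i
  induction i with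
  | zero => exact Nat.zero_le _
  | succ i ih =>
    have h1 : i < k := Nat.lt_of_succ_lt hi
    have h2 : f ⟨i, h1⟩ < f ⟨i + 1, hi⟩ := f.strictMono (Nat.lt_succ_self i)
    exact Nat.succ_le_of_lt (lt_of_le_of_lt (Fin.le_def.1 (ih h1)) (Fin.lt_def.1 h2))

section Exp

open scoped Matrix.Norms.L2Operator

theorem exp_smul_unitary_mul_realDiagonal_mul {U : Matrix n n ℂ} (hU : U ∈ unitaryGroup n ℂ)
    (d : n → ℝ) (r : ℝ) :
    NormedSpace.exp (r • (U * realDiagonal d * Uᴴ)) =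
      U * realDiagonal (fun i => Real.exp (r * d i)) * Uᴴ := by
  have h : r • (U * realDiagonal d * Uᴴ) = U * realDiagonal (r • d) * Uᴴ := by
    rw [← smul_realDiagonal, mul_smul_comm, smul_mul_assoc]
  have hsa : IsSelfAdjoint (U * realDiagonal (r • d) * Uᴴ) :=
    isHermitian_mul_mul_conjTranspose U (realDiagonal_isHermitian _)
  rw [h, ← CFC.real_exp_eq_normedSpace_exp hsa, cfc_unitary_mul_realDiagonal_mul hU]
  rfl

theorem IsHermitian.posDef_exp {X : Matrix n n ℂ} (hX : X.IsHermitian) :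
    (NormedSpace.exp X).PosDef := by
  have h := exp_smul_unitary_mul_realDiagonal_mul (hX.eigenvectorUnitary).2 hX.eigenvalues 1
  have hspec := hX.eq_unitary_mul_realDiagonal_mul
  rw [one_smul] at h
  rw [hspec, h]
  exact (realDiagonal_posDef fun i => Real.exp_pos _).mul_mul_conjTranspose_of_isUnit
    (Unitary.isUnit_coe (U := hX.eigenvectorUnitary))

theorem differentiable_compoundHom : Differentiable ℝ (compoundHom e k) := by
  have hentry : ∀ i j, Differentiable ℝ fun M : Matrix n n ℂ => M i j := fun i j =>
    (LinearMap.toContinuousLinearMap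
      ((entryLinearMap ℝ ℂ i j : Matrix n n ℂ →ₗ[ℝ] ℂ))).differentiable
  have h : (compoundHom e k : Matrix n n ℂ → _) = fun M => ∑ f, ∑ g,
      (∑ σ : Equiv.Perm (Fin k), ((Equiv.Perm.sign σ : ℤ) : ℂ) *
        ∏ i, M (e (f (σ i))) (e (g i))) • single f g (1 : ℂ) := by
    ext1 M
    conv_lhs => rw [matrix_eq_sum_single (compoundHom e k M)]
    refine Finset.sum_congr rfl fun f _ => Finset.sum_congr rfl fun g _ => ?_
    rw [compoundHom_apply, compound_apply, det_apply', smul_single, smul_eq_mul, mul_one]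
    rfl
  rw [h]
  refine Differentiable.fun_sum fun f _ => Differentiable.fun_sum fun g _ => ?_
  refine Differentiable.smul_const (Differentiable.fun_sum fun σ _ => ?_) _
  exact (differentiable_const _).mul
    fun M => (HasFDerivAt.finsetProd fun i _ =>
      (hentry (e (f (σ i))) (e (g i)) M).hasFDerivAt).differentiableAt

/-- What matters is that the derivative is linear in `X`. -/
theorem hasDerivAt_compoundHom_exp (X : Matrix n n ℂ) :
    HasDerivAt (fun r : ℝ => compoundHom e k (NormedSpace.exp (r • X)))
      (fderiv ℝ (compoundHom e k) 1 X) 0 := by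
  have h := hasDerivAt_exp_smul_const (𝕂 := ℝ) X 0
  have h1 : NormedSpace.exp ((0 : ℝ) • X) = 1 := by rw [zero_smul, NormedSpace.exp_zero]
  rw [h1, one_mul] at h
  refine HasFDerivAt.comp_hasDerivAt (x := (0 : ℝ)) (l := compoundHom e k) ?_ h
  rw [h1]
  exact (differentiable_compoundHom e k 1).hasFDerivAt

/-- The values and first derivatives at `r = 0` cancel, so the difference is `o(r)` in norm. This
one-sided estimate takes the place of a Lie–Trotter limit. -/
theorem eventually_compoundHom_mean_le (X Y : Matrix n n ℂ) (hX : X.IsHermitian)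
    (hY : Y.IsHermitian) (t : ℝ) {ε : ℝ} (hε : 0 < ε) :
    ∀ᶠ r : ℝ in nhds 0,
      (1 - t) • compoundHom e k (NormedSpace.exp (r • X)) +
        t • compoundHom e k (NormedSpace.exp (r • Y)) ≤
      compoundHom e k (NormedSpace.exp (r • ((1 - t) • X + t • Y))) + (ε * |r|) • 1 := by
  have h := (((hasDerivAt_compoundHom_exp e k X).const_smul (1 - t)).add
    ((hasDerivAt_compoundHom_exp e k Y).const_smul t)).sub
    (hasDerivAt_compoundHom_exp e k ((1 - t) • X + t • Y))
  rw [map_add, map_smul, map_smul, sub_self, hasDerivAt_iff_isLittleO] at h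
  filter_upwards [h.def hε] with r hr
  have hsa : ∀ {Z : Matrix n n ℂ}, Z.IsHermitian →
      IsSelfAdjoint (compoundHom e k (NormedSpace.exp (r • Z))) := fun {Z} hZ =>
    ((show (r • Z).IsHermitian from (IsSelfAdjoint.all r).smul hZ).posDef_exp.compoundHom e k).1
  have hsum : ((1 - t) • X + t • Y).IsHermitian :=
    ((IsSelfAdjoint.all (1 - t)).smul hX).add ((IsSelfAdjoint.all t).smul hY)
  have hsa' := ((((IsSelfAdjoint.all (1 - t)).smul (hsa hX)).add
    ((IsSelfAdjoint.all t).smul (hsa hY))).sub (hsa hsum))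
  have hle := hsa'.le_algebraMap_norm_self
  simp only [zero_smul, NormedSpace.exp_zero, map_one, Pi.add_apply, Pi.sub_apply, Pi.smul_apply,
    smul_zero, sub_zero] at hr
  have e0 : (1 - t) • (1 : Matrix (Fin k ↪o Fin m) (Fin k ↪o Fin m) ℂ) + t • 1 - 1 = 0 := by
    rw [← add_smul]; simp
  rw [e0, sub_zero, Real.norm_eq_abs] at hr
  rw [Algebra.algebraMap_eq_smul_one] at hle
  refine sub_le_iff_le_add'.1 (hle.trans ?_)
  exact smul_le_smul_of_nonneg_right hr zero_le_one

end Exp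

theorem tGeometricMean_pow_two_pow_le {A B : Matrix n n ℂ} (hA : A.PosDef) (hB : B.PosDef)
    {t : ℝ} (ht : t ∈ Set.Icc (0 : ℝ) 1) {μ : ℝ} (hμ : 0 < μ)
    (h : tGeometricMean t A B ≤ μ • 1) (j : ℕ) :
    tGeometricMean t (A ^ 2 ^ j) (B ^ 2 ^ j) ≤ (μ ^ 2 ^ j) • 1 := by
  induction j with
  | zero => simpa using h
  | succ j ih =>
    have hp : ∀ {C : Matrix n n ℂ}, C.PosDef → (C ^ 2 ^ j).PosDef := fun {C} hC => by
      rw [← CFC.rpow_natCast C _ hC.posSemidef.nonneg]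
      exact hC.rpow _
    simp only [pow_succ 2 j, pow_mul _ (2 ^ j) 2]
    rw [pow_two (A ^ _), pow_two (B ^ _)]
    exact tGeometricMean_mul_self_le (hp hA) (hp hB) ht (pow_pos hμ _) ih

/-- Log-majorization of the eigenvalues of the geometric mean by those of the log Euclidean
mean. -/
theorem sum_log_eigenvalues_le {A B X Y : Matrix n n ℂ} (hX : X.IsHermitian) (hY : Y.IsHermitian)
    (hAX : NormedSpace.exp X = A) (hBY : NormedSpace.exp Y = B)
    {t : ℝ} (ht : t ∈ Set.Icc (0 : ℝ) 1) {U V : Matrix n n ℂ} (hU : U ∈ unitaryGroup n ℂ)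
    (hV : V ∈ unitaryGroup n ℂ) {g l : n → ℝ} (hg : ∀ i, 0 < g i)
    (hG : tGeometricMean t A B = U * realDiagonal g * Uᴴ)
    (hL : (1 - t) • X + t • Y = V * realDiagonal l * Vᴴ) (hl : Antitone (l ∘ e)) (hk : k ≤ m) :
    ∑ i : Fin k, Real.log (g (e (Fin.castLE hk i))) ≤ ∑ i : Fin k, l (e (Fin.castLE hk i)) := by
  set s := ∑ i : Fin k, l (e (Fin.castLE hk i)) with hs
  refine le_of_forall_pos_le_add fun δ hδ => ?_
  -- As `0 < r ≤ 1` gives `e^{-|s|} ≤ e^{rs}`, this choice makes `ε r ≤ e^{rs} r δ`, which is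
  -- absorbed into `e^{r(s+δ)}`.
  obtain ⟨ε, hε, hεδ⟩ : ∃ ε > 0, ε * Real.exp |s| = δ :=
    ⟨δ / Real.exp |s|, by positivity, by field_simp⟩
  obtain ⟨ρ, hρ, hball⟩ := Metric.eventually_nhds_iff.1
    (eventually_compoundHom_mean_le e k X Y hX hY t hε)
  obtain ⟨j, hj⟩ := exists_pow_lt_of_lt_one hρ (show (1 / 2 : ℝ) < 1 by norm_num)
  set r : ℝ := (1 / 2) ^ j with hr
  have hr0 : 0 < r := by positivity
  have hr1 : r ≤ 1 := pow_le_one₀ (by norm_num) (by norm_num)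
  have hrj : (2 ^ j : ℕ) * r = 1 := by
    rw [hr, Nat.cast_pow, ← mul_pow]
    norm_num
  have hball := hball (y := r) (by rwa [Real.dist_eq, sub_zero, abs_of_pos hr0])
  rw [hL, exp_smul_unitary_mul_realDiagonal_mul hV, abs_of_pos hr0] at hball
  have hC : compoundHom e k (V * realDiagonal (fun i => Real.exp (r * l i)) * Vᴴ) ≤
      Real.exp (r * s) • 1 := by
    rw [compoundHom_le_smul_one_iff e k hV]
    intro f
    rw [← Real.exp_sum, ← Finset.mul_sum]
    refine Real.exp_le_exp.2 (mul_le_mul_of_nonneg_left ?_ hr0.le)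
    exact Finset.sum_le_sum fun i _ => hl (Fin.castLE_le_orderEmbedding hk f i)
  have hpow : ∀ {Z : Matrix n n ℂ}, compoundHom e k (NormedSpace.exp (r • Z)) ^ 2 ^ j =
      compoundHom e k (NormedSpace.exp Z) := fun {Z} => by
    rw [← map_pow, ← exp_nsmul, ← Nat.cast_smul_eq_nsmul ℝ, smul_smul, hrj, one_smul]
  have hpd : ∀ {Z : Matrix n n ℂ}, Z.IsHermitian →
      (compoundHom e k (NormedSpace.exp (r • Z))).PosDef := fun {Z} hZ =>
    (show (r • Z).IsHermitian from (IsSelfAdjoint.all r).smul hZ).posDef_exp.compoundHom e k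
  have h1 : tGeometricMean t (compoundHom e k (NormedSpace.exp (r • X)))
      (compoundHom e k (NormedSpace.exp (r • Y))) ≤ (Real.exp (r * s) + ε * r) • 1 := by
    refine (tGeometricMean_le_arith (hpd hX) (hpd hY) ht).trans (hball.trans ?_)
    rw [add_smul]
    exact add_le_add_left hC _
  -- Since `2^j r = 1`, the `2^j`-th powers of the compounds of `e^{rX}` and `e^{rY}` are the
  -- compounds of `A` and `B`.
  have h2 := tGeometricMean_pow_two_pow_le (hpd hX) (hpd hY) ht (by positivity) h1 j
  rw [hpow, hpow, hAX, hBY, ← compoundHom_tGeometricMean e k (hAX ▸ hX.posDef_exp)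
    (hBY ▸ hY.posDef_exp), hG, compoundHom_le_smul_one_iff e k hU] at h2
  have h3 : ∏ i, g (e (Fin.castLE hk i)) ≤ Real.exp (s + δ) := by
    refine (h2 (Fin.castLEOrderEmb hk)).trans ?_
    have h4 : Real.exp (r * s) + ε * r ≤ Real.exp (r * (s + δ)) := by
      have h5 : ε * r ≤ Real.exp (r * s) * (r * δ) := by
        have h6 : 1 ≤ Real.exp (r * s) * Real.exp |s| := by
          rw [← Real.exp_add]
          refine Real.one_le_exp ?_
          have := neg_abs_le s
          have := abs_nonneg s
          nlinarith
        calc ε * r = (ε * r) * 1 := (mul_one _).symm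
          _ ≤ (ε * r) * (Real.exp (r * s) * Real.exp |s|) :=
            mul_le_mul_of_nonneg_left h6 (by positivity)
          _ = _ := by rw [← hεδ]; ring
      calc _ ≤ Real.exp (r * s) * (1 + r * δ) := by linarith
        _ ≤ Real.exp (r * s) * Real.exp (r * δ) := by
          refine mul_le_mul_of_nonneg_left ?_ (Real.exp_pos _).le
          linarith [Real.add_one_le_exp (r * δ)]
        _ = _ := by rw [← Real.exp_add, mul_add]
    calc _ ≤ Real.exp (r * (s + δ)) ^ 2 ^ j := pow_le_pow_left₀ (by positivity) h4 _
      _ = _ := by rw [← Real.exp_nat_mul, ← mul_assoc, hrj, one_mul]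
  rw [← Real.log_prod fun i _ => (hg _).ne']
  exact (Real.log_le_iff_le_exp (Finset.prod_pos fun i _ => hg _)).2 h3

end Matrix

/-! ### Majorization and symmetric gauge functions -/

section UnitarilyInvariantNorm

open Matrix

/-- Summation by parts against a nonnegative antitone sequence. -/
theorem mul_sum_le_sum_mul_of_antitone {m : ℕ} {c z : Fin m → ℝ} (hc : Antitone c)
    (hz : ∀ (k : ℕ) (hk : k ≤ m), 0 ≤ ∑ i : Fin k, z (Fin.castLE hk i)) {a : ℝ}
    (ha : ∀ i, a ≤ c i) : a * ∑ i, z i ≤ ∑ i, c i * z i := by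
  induction m generalizing a with
  | zero => simp
  -- The induction hypothesis is used with the last weight as lower bound, hence the generalization
  -- over `a`.
  | succ m ih =>
    have h := ih (c := fun i => c i.castSucc) (z := fun i => z i.castSucc)
      (fun i j hij => hc (Fin.castSucc_le_castSucc_iff.2 hij))
      (fun k hk => hz k (hk.trans (Nat.le_succ m))) (a := c (Fin.last m))
      (fun i => hc (Fin.le_last _))
    have h' : 0 ≤ ∑ i, z i := hz (m + 1) le_rfl
    calc a * ∑ i, z i ≤ c (Fin.last m) * ∑ i, z i := mul_le_mul_of_nonneg_right (ha _) h'
      _ ≤ _ := by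
        rw [Fin.sum_univ_castSucc, Fin.sum_univ_castSucc (f := fun i => c i * z i), mul_add]
        linarith

theorem sum_mul_nonneg_of_antitone {m : ℕ} {c z : Fin m → ℝ} (hc : Antitone c)
    (hc0 : ∀ i, 0 ≤ c i) (hz : ∀ (k : ℕ) (hk : k ≤ m), 0 ≤ ∑ i : Fin k, z (Fin.castLE hk i)) :
    0 ≤ ∑ i, c i * z i := by
  simpa using mul_sum_le_sum_mul_of_antitone hc hz hc0

/-- Weak log-majorization gives weak majorization, tested against antitone weights. -/
theorem sum_mul_le_sum_mul_of_sum_log_le {m : ℕ} {c g h : Fin m → ℝ} (hc : Antitone c)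
    (hc0 : ∀ i, 0 ≤ c i) (hg : Antitone g) (hg0 : ∀ i, 0 < g i) (hh0 : ∀ i, 0 < h i)
    (hlog : ∀ (k : ℕ) (hk : k ≤ m), ∑ i : Fin k, Real.log (g (Fin.castLE hk i)) ≤
      ∑ i : Fin k, Real.log (h (Fin.castLE hk i))) :
    ∑ i, c i * g i ≤ ∑ i, c i * h i := by
  -- The weights `c g` are still decreasing, and `g log(h/g) ≤ h - g` passes from logarithms to
  -- values.
  have key := sum_mul_nonneg_of_antitone (c := fun i => c i * g i)
    (z := fun i => Real.log (h i) - Real.log (g i))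
    (fun i j hij => mul_le_mul (hc hij) (hg hij) (hg0 _).le (hc0 _))
    (fun i => mul_nonneg (hc0 i) (hg0 i).le)
    (fun k hk => by
      rw [Finset.sum_sub_distrib]
      exact sub_nonneg.2 (hlog k hk))
  rw [← sub_nonneg, ← Finset.sum_sub_distrib]
  refine key.trans (Finset.sum_le_sum fun i _ => ?_)
  rw [← mul_sub, mul_assoc]
  refine mul_le_mul_of_nonneg_left ?_ (hc0 i)
  have h1 := Real.log_le_sub_one_of_pos (div_pos (hh0 i) (hg0 i))
  rw [Real.log_div (hh0 i).ne' (hg0 i).ne'] at h1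
  calc g i * (Real.log (h i) - Real.log (g i)) ≤ g i * (h i / g i - 1) :=
        mul_le_mul_of_nonneg_left h1 (hg0 i).le
    _ = h i - g i := by
      have := (hg0 i).ne'
      field_simp

namespace IsUnitarilyInvariantNorm

variable {n : Type*} [Fintype n] [DecidableEq n] {N : Seminorm ℂ (Matrix n n ℂ)}

theorem map_unitary_mul_mul_conjTranspose (hN : IsUnitarilyInvariantNorm N) {U : Matrix n n ℂ}
    (hU : U ∈ unitaryGroup n ℂ) (X : Matrix n n ℂ) : N (U * X * Uᴴ) = N X :=
  hN.unitary_mul_mul U hU Uᴴ (Unitary.star_mem hU) X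

theorem map_unitary_mul (hN : IsUnitarilyInvariantNorm N) {U : Matrix n n ℂ}
    (hU : U ∈ unitaryGroup n ℂ) (X : Matrix n n ℂ) : N (U * X) = N X := by
  simpa using hN.unitary_mul_mul U hU 1 (one_mem _) X

theorem map_realDiagonal_comp_perm (hN : IsUnitarilyInvariantNorm N) (d : n → ℝ)
    (σ : Equiv.Perm n) : N (realDiagonal (d ∘ σ)) = N (realDiagonal d) := by
  have hP : σ.permMatrix ℂ * (σ.permMatrix ℂ)ᴴ = 1 := by
    rw [conjTranspose_permMatrix, ← permMatrix_mul]
    simp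
  have hU : σ.permMatrix ℂ ∈ unitaryGroup n ℂ := mem_unitaryGroup_iff.2 hP
  rw [← hN.map_unitary_mul_mul_conjTranspose hU (realDiagonal d)]
  congr 1
  rw [conjTranspose_permMatrix]
  ext i j
  rw [Matrix.mul_apply]
  simp [realDiagonal, Matrix.mul_apply, Equiv.Perm.permMatrix, PEquiv.toMatrix_apply,
    diagonal_apply, Equiv.toPEquiv_apply, Equiv.symm_apply_eq]
  split_ifs with h
  · rw [h]
  · rfl

/-- A symmetric gauge function does not increase under multiplication by a contraction. -/
theorem map_realDiagonal_mul_le (hN : IsUnitarilyInvariantNorm N) {c : n → ℝ}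
    (hc : ∀ i, |c i| ≤ 1) (d : n → ℝ) :
    N (realDiagonal (c * d)) ≤ N (realDiagonal d) := by
  have hs : ∀ i, 0 ≤ 1 - c i ^ 2 := fun i => sub_nonneg.2 ((sq_le_one_iff_abs_le_one _).2 (hc i))
  -- A real number in `[-1, 1]` is the average of a unimodular number and its conjugate, so `diag c`
  -- averages two unitaries.
  let w : n → ℂ := fun i => ⟨c i, √(1 - c i ^ 2)⟩
  have hw : ∀ i, w i * star (w i) = 1 := fun i => by
    refine Complex.ext ?_ ?_
    · have := Real.mul_self_sqrt (hs i)
      simp [w]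
      linarith
    · simp [w]
      ring
  have hW : diagonal w ∈ unitaryGroup n ℂ := by
    rw [mem_unitaryGroup_iff, star_eq_conjTranspose, diagonal_conjTranspose,
      diagonal_mul_diagonal, ← diagonal_one]
    exact congrArg _ (funext hw)
  have hW' : (diagonal w)ᴴ ∈ unitaryGroup n ℂ := Unitary.star_mem hW
  have he : realDiagonal (c * d) = (1 / 2 : ℂ) • (diagonal w * realDiagonal d) +
      (1 / 2 : ℂ) • ((diagonal w)ᴴ * realDiagonal d) := by
    rw [realDiagonal, realDiagonal, diagonal_conjTranspose, diagonal_mul_diagonal,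
      diagonal_mul_diagonal, ← diagonal_smul, ← diagonal_smul, diagonal_add]
    congr 1
    ext i
    refine Complex.ext ?_ ?_
    · simp [w]
      ring
    · simp [w]
  rw [he]
  refine (map_add_le_add N _ _).trans ?_
  rw [map_smul_eq_mul, map_smul_eq_mul, hN.map_unitary_mul hW, hN.map_unitary_mul hW']
  norm_num
  linarith

theorem map_realDiagonal_mono (hN : IsUnitarilyInvariantNorm N) {d d' : n → ℝ}
    (hd : ∀ i, 0 ≤ d i) (hdd' : ∀ i, d i ≤ d' i) :
    N (realDiagonal d) ≤ N (realDiagonal d') := by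
  have h : d = (fun i => d i / d' i) * d' := by
    ext i
    rw [Pi.mul_apply]
    by_cases h0 : d' i = 0
    · rw [h0, mul_zero]
      exact le_antisymm (h0 ▸ hdd' i) (hd i)
    · rw [div_mul_cancel₀ _ h0]
  conv_lhs => rw [h]
  refine hN.map_realDiagonal_mul_le (fun i => ?_) d'
  have h0 : 0 ≤ d' i := (hd i).trans (hdd' i)
  rw [abs_of_nonneg (div_nonneg (hd i) h0)]
  exact div_le_one_of_le₀ (hdd' i) h0

end IsUnitarilyInvariantNorm

section Gauge

variable {n : Type*} [DecidableEq n] (N : Seminorm ℂ (Matrix n n ℂ))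

/-- The gauge function of a matrix norm: its restriction to real diagonal matrices. -/
noncomputable def diagonalGauge : Seminorm ℝ (n → ℝ) :=
  (N.restrictScalars ℝ).comp
    ({ toFun := realDiagonal
       map_add' := fun d e => (realDiagonal_add d e).symm
       map_smul' := fun c d => (smul_realDiagonal c d).symm } : (n → ℝ) →ₗ[ℝ] Matrix n n ℂ)

theorem diagonalGauge_apply (d : n → ℝ) : diagonalGauge N d = N (realDiagonal d) := rfl

/-- A supporting functional of a seminorm on `n → ℝ`. -/
theorem Seminorm.exists_supporting_functional [Fintype n] (q : Seminorm ℝ (n → ℝ)) (g : n → ℝ) :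
    ∃ w : n → ℝ, ∑ i, w i * g i = q g ∧ ∀ x, ∑ i, w i * x i ≤ q x := by
  obtain ⟨f, hf, hfq⟩ : ∃ f : Module.Dual ℝ (n → ℝ), f g = q g ∧ ∀ x, |f x| ≤ q x := by
    by_cases hg : g = 0
    · exact ⟨0, by simp [hg], fun x => by simp⟩
    -- Hahn–Banach extension of `c • g ↦ c * q g` from the line through `g`.
    · let F : (n → ℝ) →ₗ.[ℝ] ℝ := LinearPMap.mkSpanSingleton g (q g) hg
      obtain ⟨f, hf, hfq⟩ := Module.Dual.exists_extension_of_le_seminorm_real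
        (ℝ ∙ g) F.toFun (p := q) (by
          rintro ⟨x, hx⟩
          obtain ⟨c, rfl⟩ := Submodule.mem_span_singleton.1 hx
          have h : F.toFun ⟨c • g, hx⟩ = c * q g :=
            LinearPMap.mkSpanSingleton'_apply (σ := RingHom.id ℝ) g (q g) _ c hx
          refine h.trans_le ?_
          rw [map_smul_eq_mul]
          exact mul_le_mul_of_nonneg_right (le_abs_self c) (apply_nonneg q g))
      refine ⟨f, ?_, hfq⟩
      rw [hf ⟨g, Submodule.mem_span_singleton_self g⟩]
      exact LinearPMap.mkSpanSingleton_apply ℝ ℝ hg (q g)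
  have hsum : ∀ x : n → ℝ, ∑ i, f (Pi.single i 1) * x i = f x := fun x => by
    conv_rhs => rw [LinearMap.pi_apply_eq_sum_univ f x]
    refine Finset.sum_congr rfl fun i _ => ?_
    rw [smul_eq_mul, mul_comm]
    congr 2
    ext j
    simp [Pi.single_apply, eq_comm]
  exact ⟨fun i => f (Pi.single i 1), by rw [hsum, hf],
    fun x => by rw [hsum]; exact (le_abs_self _).trans (hfq x)⟩

end Gauge

namespace IsUnitarilyInvariantNorm

variable {n : Type*} [Fintype n] [DecidableEq n] {N : Seminorm ℂ (Matrix n n ℂ)}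

/-- Fan dominance for positive diagonal matrices, under weak log-majorization. -/
theorem map_realDiagonal_le_of_sum_log_le (hN : IsUnitarilyInvariantNorm N) {m : ℕ}
    (e : Fin m ≃ n) {g h : n → ℝ} (hg : Antitone (g ∘ e))
    (hg0 : ∀ i, 0 < g i) (hh0 : ∀ i, 0 < h i)
    (hlog : ∀ (k : ℕ) (hk : k ≤ m), ∑ i : Fin k, Real.log (g (e (Fin.castLE hk i))) ≤
      ∑ i : Fin k, Real.log (h (e (Fin.castLE hk i)))) :
    N (realDiagonal g) ≤ N (realDiagonal h) := by
  obtain ⟨w, hwg, hw⟩ := (diagonalGauge N).exists_supporting_functional g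
  simp only [diagonalGauge_apply] at hwg hw
  -- As `g` is positive and decreasing, replacing `w` by its decreasing rearrangement in absolute
  -- value only increases the pairing. The permutation and signs are then moved onto `h`, where they
  -- do not increase the norm.
  let w' : Fin m → ℝ := fun i => |w (e i)|
  let τ : Equiv.Perm (Fin m) := Tuple.sort fun i => -w' i
  have hv : Antitone (w' ∘ τ) := fun i j hij =>
    neg_le_neg_iff.1 (Tuple.monotone_sort (fun i => -w' i) hij)
  let π : Equiv.Perm n := e.symm.trans (τ.symm.trans e)
  calc N (realDiagonal g) = ∑ i, w (e i) * g (e i) := by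
        rw [← hwg, ← e.sum_comp]
    _ ≤ ∑ i, w' i * g (e i) := Finset.sum_le_sum fun i _ =>
        mul_le_mul_of_nonneg_right (le_abs_self _) (hg0 _).le
    _ = ∑ i, (w' ∘ τ) (τ.symm i) * (g ∘ e) i := by simp
    _ ≤ ∑ i, (w' ∘ τ) i * (g ∘ e) i :=
        (hv.monovary hg).sum_comp_perm_mul_le_sum_mul
    _ ≤ ∑ i, (w' ∘ τ) i * (h ∘ e) i :=
        sum_mul_le_sum_mul_of_sum_log_le hv (fun i => abs_nonneg _) hg (fun i => hg0 _)
          (fun i => hh0 _) hlog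
    _ = ∑ x, w x * ((fun x => (SignType.sign (w x) : ℝ)) * (h ∘ π)) x := by
        conv_rhs => rw [← e.sum_comp, ← Equiv.sum_comp τ]
        refine Finset.sum_congr rfl fun i _ => ?_
        simp only [Function.comp_apply, Pi.mul_apply, π, w', Equiv.trans_apply,
          Equiv.symm_apply_apply]
        rw [← mul_assoc, self_mul_sign]
    _ ≤ N (realDiagonal ((fun x => (SignType.sign (w x) : ℝ)) * (h ∘ π))) := hw _
    _ ≤ N (realDiagonal (h ∘ π)) := hN.map_realDiagonal_mul_le (fun i => by
        rcases lt_trichotomy (w i) 0 with h | h | h <;> simp [h]) _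
    _ = N (realDiagonal h) := hN.map_realDiagonal_comp_perm h π

/-- By Birkhoff's theorem `S` is a convex combination of permutation matrices, and the gauge is
convex and permutation invariant. -/
theorem map_realDiagonal_mulVec_le (hN : IsUnitarilyInvariantNorm N) {S : Matrix n n ℝ}
    (hS : S ∈ doublyStochastic ℝ n) (d : n → ℝ) :
    N (realDiagonal (S *ᵥ d)) ≤ N (realDiagonal d) := by
  have hS' : S ∈ (doublyStochastic ℝ n : Set (Matrix n n ℝ)) := hS
  rw [doublyStochastic_eq_convexHull_permMatrix] at hS'
  have hconv : Convex ℝ {S : Matrix n n ℝ | diagonalGauge N (S *ᵥ d) ≤ N (realDiagonal d)} := by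
    intro S hS T hT a b ha hb hab
    simp only [Set.mem_ofPred_eq] at hS hT ⊢
    rw [add_mulVec, smul_mulVec, smul_mulVec]
    refine (map_add_le_add _ _ _).trans ?_
    rw [map_smul_eq_mul, map_smul_eq_mul, Real.norm_of_nonneg ha, Real.norm_of_nonneg hb]
    calc _ ≤ a * N (realDiagonal d) + b * N (realDiagonal d) := by gcongr
      _ = _ := by rw [← add_mul, hab, one_mul]
  refine convexHull_min ?_ hconv hS'
  rintro _ ⟨σ, rfl⟩
  rw [Set.mem_ofPred_eq, permMatrix_mulVec, diagonalGauge_apply, hN.map_realDiagonal_comp_perm]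

open scoped Matrix.Norms.L2Operator in
/-- Unitarily invariant norms of exponentials are monotone in the Loewner order. -/
theorem map_exp_le_map_exp (hN : IsUnitarilyInvariantNorm N) {L K : Matrix n n ℂ}
    (hL : L.IsHermitian) (hK : K.IsHermitian) (hLK : L ≤ K) :
    N (NormedSpace.exp L) ≤ N (NormedSpace.exp K) := by
  set U : Matrix n n ℂ := hL.eigenvectorUnitary.1
  set V : Matrix n n ℂ := hK.eigenvectorUnitary.1
  have hU : U ∈ unitaryGroup n ℂ := hL.eigenvectorUnitary.2
  have hV : V ∈ unitaryGroup n ℂ := hK.eigenvectorUnitary.2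
  obtain ⟨l, hl⟩ : ∃ l, L = U * realDiagonal l * Uᴴ := ⟨_, hL.eq_unitary_mul_realDiagonal_mul⟩
  obtain ⟨κ, hκ⟩ : ∃ κ, K = V * realDiagonal κ * Vᴴ := ⟨_, hK.eq_unitary_mul_realDiagonal_mul⟩
  clear_value U V
  have hexpL := exp_smul_unitary_mul_realDiagonal_mul hU l 1
  have hexpK := exp_smul_unitary_mul_realDiagonal_mul hV κ 1
  simp only [one_smul, one_mul, ← hl, ← hκ] at hexpL hexpK
  rw [hexpL, hexpK, hN.map_unitary_mul_mul_conjTranspose hU,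
    hN.map_unitary_mul_mul_conjTranspose hV]
  set W := Uᴴ * V with hWdef
  have hUU : Uᴴ * U = 1 := mem_unitaryGroup_iff'.1 hU
  have hW : W ∈ unitaryGroup n ℂ := mul_mem (Unitary.star_mem hU) hV
  have hWW : W * Wᴴ = 1 := mem_unitaryGroup_iff.1 hW
  have hWW' : Wᴴ * W = 1 := mem_unitaryGroup_iff'.1 hW
  let S : Matrix n n ℝ := of fun i j => Complex.normSq (W i j)
  have hS : S ∈ doublyStochastic ℝ n := by
    rw [mem_doublyStochastic_iff_sum]
    refine ⟨fun i j => Complex.normSq_nonneg _, fun i => ?_, fun j => ?_⟩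
    · have := congrFun (congrFun hWW i) i
      rw [mul_apply, one_apply_eq] at this
      simp only [conjTranspose_apply, RCLike.star_def, Complex.mul_conj] at this
      exact_mod_cast this
    · have := congrFun (congrFun hWW' j) j
      rw [mul_apply, one_apply_eq] at this
      simp only [conjTranspose_apply, RCLike.star_def, ← Complex.normSq_eq_conj_mul_self] at this
      exact_mod_cast this
  have hle : realDiagonal l ≤ W * realDiagonal κ * Wᴴ := by
    have h := mul_mul_conjTranspose_le hLK Uᴴ
    have e1 : Uᴴ * L * Uᴴᴴ = realDiagonal l := by
      rw [hl, conjTranspose_conjTranspose]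
      calc _ = (Uᴴ * U) * realDiagonal l * (Uᴴ * U) := by simp only [Matrix.mul_assoc]
        _ = _ := by rw [hUU, Matrix.one_mul, Matrix.mul_one]
    have e2 : Uᴴ * K * Uᴴᴴ = W * realDiagonal κ * Wᴴ := by
      rw [hκ, hWdef, conjTranspose_mul]
      simp only [Matrix.mul_assoc]
    rwa [e1, e2] at h
  -- Only the diagonal entries of `L ≤ K` in an eigenbasis of `L` are needed.
  have hentry : ∀ i, l i ≤ (S *ᵥ κ) i := fun i => by
    have h := (le_iff.1 hle).diag_nonneg (i := i)
    rw [Matrix.sub_apply, sub_nonneg] at h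
    have e3 : (W * realDiagonal κ * Wᴴ) i i = (((S *ᵥ κ) i : ℝ) : ℂ) := by
      rw [mul_apply]
      simp only [realDiagonal, mul_diagonal, conjTranspose_apply, RCLike.star_def]
      simp only [mulVec, dotProduct, S, of_apply, Complex.ofReal_sum, Complex.ofReal_mul,
        ← Complex.mul_conj]
      exact Finset.sum_congr rfl fun j _ => by ring
    rw [e3, realDiagonal, diagonal_apply_eq] at h
    exact_mod_cast h
  -- Jensen gives `e^l ≤ e^{Sκ} ≤ S e^κ` entrywise, and `S` does not increase the gauge.
  refine (hN.map_realDiagonal_mono (fun i => (Real.exp_pos _).le) fun i => ?_).trans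
    (hN.map_realDiagonal_mulVec_le hS _)
  refine (Real.exp_le_exp.2 (hentry i)).trans ?_
  have hj := convexOn_exp.map_sum_le (t := Finset.univ) (w := fun j => S i j) (p := κ)
    (fun j _ => nonneg_of_mem_doublyStochastic hS) (sum_row_of_mem_doublyStochastic hS i)
    (fun j _ => Set.mem_univ _)
  simpa [mulVec, dotProduct] using hj

end IsUnitarilyInvariantNorm

/-! ### Logarithms and operator concavity -/

section Log

open scoped Matrix.Norms.L2Operator

variable {n : Type*} [Fintype n] [DecidableEq n]

theorem matrixLog_eq_log (A : Matrix n n ℂ) : matrixLog A = CFC.log A := rfl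

theorem matrixLog_isHermitian (A : Matrix n n ℂ) : (matrixLog A).IsHermitian :=
  IsSelfAdjoint.log (a := A)

theorem Matrix.PosDef.exp_matrixLog {A : Matrix n n ℂ} (hA : A.PosDef) :
    NormedSpace.exp (matrixLog A) = A :=
  CFC.exp_log A (isStrictlyPositive_iff_posDef.2 hA)

theorem Matrix.PosDef.exp_smul_matrixLog {A : Matrix n n ℂ} (hA : A.PosDef) (r : ℝ) :
    NormedSpace.exp (r • matrixLog A) = A ^ r := by
  obtain ⟨U, hU, d, hd, rfl⟩ : ∃ U ∈ unitaryGroup n ℂ, ∃ d : n → ℝ, (∀ i, 0 < d i) ∧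
      A = U * realDiagonal d * Uᴴ :=
    ⟨_, hA.1.eigenvectorUnitary.2, _, hA.eigenvalues_pos, hA.1.eq_unitary_mul_realDiagonal_mul⟩
  rw [matrixLog, cfc_unitary_mul_realDiagonal_mul hU, exp_smul_unitary_mul_realDiagonal_mul hU,
    unitary_mul_realDiagonal_mul_rpow hU hd]
  congr 3
  ext i
  rw [Real.rpow_def_of_pos (hd i), mul_comm]
  rfl

theorem Matrix.PosDef.matrixLog_rpow {A : Matrix n n ℂ} (hA : A.PosDef) (r : ℝ) :
    matrixLog (A ^ r) = r • matrixLog A := by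
  rw [← hA.exp_smul_matrixLog, matrixLog_eq_log]
  exact CFC.log_exp _ ((IsSelfAdjoint.all r).smul (matrixLog_isHermitian A))

/-- Positive definite matrices are closed under convex combinations. -/
theorem Matrix.PosDef.convex_combination {A B : Matrix n n ℂ} (hA : A.PosDef) (hB : B.PosDef)
    {t : ℝ} (ht₀ : 0 ≤ t) (ht₁ : t ≤ 1) : ((1 - t) • A + t • B).PosDef := by
  -- The domain half of concavity: the strictly positive cone is convex.
  have h := (CFC.concaveOn_log (A := Matrix n n ℂ)).1 (isStrictlyPositive_iff_posDef.2 hA)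
    (isStrictlyPositive_iff_posDef.2 hB) (sub_nonneg.2 ht₁) ht₀ (by ring)
  exact isStrictlyPositive_iff_posDef.1 h

/-- The logarithm of the log Euclidean mean is at most that of the power mean. -/
theorem smul_matrixLog_add_le {A B : Matrix n n ℂ} (hA : A.PosDef) (hB : B.PosDef)
    {t p : ℝ} (ht₀ : 0 ≤ t) (ht₁ : t ≤ 1) (hp : 0 < p) :
    (1 - t) • matrixLog A + t • matrixLog B ≤
      (1 / p) • matrixLog ((1 - t) • A ^ p + t • B ^ p) := by
  have h : (1 - t) • matrixLog (A ^ p) + t • matrixLog (B ^ p) ≤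
      matrixLog ((1 - t) • A ^ p + t • B ^ p) :=
    (CFC.concaveOn_log (A := Matrix n n ℂ)).2
      (isStrictlyPositive_iff_posDef.2 (hA.rpow p))
      (isStrictlyPositive_iff_posDef.2 (hB.rpow p)) (sub_nonneg.2 ht₁) ht₀ (by ring)
  rw [hA.matrixLog_rpow, hB.matrixLog_rpow] at h
  have h' := smul_le_smul_of_nonneg_left h (one_div_pos.2 hp).le
  convert h' using 1
  rw [smul_comm (1 - t) p, smul_comm t p, ← smul_add, smul_smul, one_div_mul_cancel hp.ne',
    one_smul]

end Log

end UnitarilyInvariantNorm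

/-! ### The two inequalities -/

open Matrix in
theorem IsUnitarilyInvariantNorm.map_tGeometricMean_le {n : Type*} [Fintype n] [DecidableEq n]
    {N : Seminorm ℂ (Matrix n n ℂ)} (hN : IsUnitarilyInvariantNorm N)
    {A B : Matrix n n ℂ} (hA : A.PosDef) (hB : B.PosDef) {t : ℝ} (ht : t ∈ Set.Icc (0 : ℝ) 1) :
    N (tGeometricMean t A B) ≤ N (logEuclideanMean t A B) := by
  have hG := hA.tGeometricMean hB t
  have hX := matrixLog_isHermitian A
  have hY := matrixLog_isHermitian B
  have hL : ((1 - t) • matrixLog A + t • matrixLog B).IsHermitian :=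
    ((IsSelfAdjoint.all (1 - t)).smul hX).add ((IsSelfAdjoint.all t).smul hY)
  -- This is the enumeration built into `IsHermitian.eigenvalues`, so composing with it gives the
  -- decreasing `eigenvalues₀`.
  let e : Fin (Fintype.card n) ≃ n := Fintype.equivOfCardEq (Fintype.card_fin _)
  have hanti : ∀ {M : Matrix n n ℂ} (hM : M.IsHermitian), Antitone (hM.eigenvalues ∘ e) :=
    fun hM i j hij => by
      simpa [IsHermitian.eigenvalues, e] using hM.eigenvalues₀_antitone hij
  have hGs := hG.1.eq_unitary_mul_realDiagonal_mul
  have hLs := hL.eq_unitary_mul_realDiagonal_mul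
  have hexp := exp_smul_unitary_mul_realDiagonal_mul hL.eigenvectorUnitary.2 hL.eigenvalues 1
  rw [← hLs, one_smul] at hexp
  have hNG : N (tGeometricMean t A B) = N (realDiagonal hG.1.eigenvalues) :=
    (congrArg N hGs).trans (hN.map_unitary_mul_mul_conjTranspose hG.1.eigenvectorUnitary.2 _)
  rw [hNG, logEuclideanMean, hexp,
    hN.map_unitary_mul_mul_conjTranspose hL.eigenvectorUnitary.2]
  refine hN.map_realDiagonal_le_of_sum_log_le e (hanti hG.1)
    hG.eigenvalues_pos (fun i => Real.exp_pos _)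
    fun k hk => ?_
  simp only [Real.log_exp, one_mul]
  exact sum_log_eigenvalues_le e k hX hY hA.exp_matrixLog hB.exp_matrixLog ht
    hG.1.eigenvectorUnitary.2 hL.eigenvectorUnitary.2 hG.eigenvalues_pos hGs hLs (hanti hL) hk

theorem corollary2 {n : Type*} [Fintype n] [DecidableEq n]
    (N : Seminorm ℂ (Matrix n n ℂ)) (hN : IsUnitarilyInvariantNorm N)
    (A B : Matrix n n ℂ) (hA : A.PosDef) (hB : B.PosDef)
    (t : ℝ) (ht₀ : 0 ≤ t) (ht₁ : t ≤ 1) (p : ℝ) (hp : 0 < p) :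
    N (tGeometricMean t A B) ≤ N (logEuclideanMean t A B) ∧
      N (logEuclideanMean t A B) ≤ N (matrixPowerMean t p A B) := by
  refine ⟨hN.map_tGeometricMean_le hA hB ⟨ht₀, ht₁⟩, ?_⟩
  have hM := (hA.rpow p).convex_combination (hB.rpow p) ht₀ ht₁
  rw [logEuclideanMean, matrixPowerMean, ← hM.exp_smul_matrixLog]
  exact hN.map_exp_le_map_exp
    (((IsSelfAdjoint.all (1 - t)).smul (matrixLog_isHermitian A)).add
      ((IsSelfAdjoint.all t).smul (matrixLog_isHermitian B)))
    ((IsSelfAdjoint.all (1 / p)).smul (matrixLog_isHermitian _))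
    (smul_matrixLog_add_le hA hB ht₀ ht₁ hp)
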